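/- Let $\Gamma$ be a finitely generated group with a normal subgroup $V$ which is free abelian of finite rank $r$ and such that the quotient $N=\Gamma/V$ is nilpotent. The conjugation action of $\Gamma$ on $V$ induces an action of $N$ on $V$. Suppose that for every element of $N$, all complex eigenvalues of the automorphism it induces on $V$ (that is, all eigenvalues of the induced automorphism of $V\otimes_{\mathbb Z}\mathbb C$) have absolute value $1$. Then $\Gamma$ is nilpotent-by-finite, i.e. it has a nilpotent subgroup of finite index. Moreover, $\Gamma$ has polynomial growth: there is an integer $d\ge 0$ such that for every finite generating set $S$ of $\Gamma$ there is a constant $C$ such that, for all $n\ge 1$, the number of elements of $\Gamma$ that are products of at most $n$ elements of $S\cup S^{-1}$ is at most $C n^d$. -/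

import Mathlib

open scoped TensorProduct IsMulCommutative

/-- If `V` is an abelian normal subgroup of `Γ`, the conjugation action of `Γ` on `V` factors
through `Γ ⧸ V`. -/
def quotientConj {Γ : Type*} [Group Γ] (V : Subgroup Γ) [V.Normal] [IsMulCommutative V] :
    (Γ ⧸ V) →* MulAut V :=
  QuotientGroup.lift V (MulAut.conjNormal (H := V)) (by
    intro v hv
    ext x
    have h : (⟨v, hv⟩ : V) * x = x * ⟨v, hv⟩ := mul_comm _ _
    have h' : v * (x : Γ) = x * v := congrArg Subtype.val h
    simp [h'])

/-- The automorphism of the abelian group `V` (written additively, as a `ℤ`-module) by which an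
element of the quotient `Γ ⧸ V` acts, i.e. conjugation by any lift to `Γ`. -/
def quotientAction {Γ : Type*} [Group Γ] (V : Subgroup Γ) [V.Normal] [IsMulCommutative V]
    (q : Γ ⧸ V) : Module.End ℤ (Additive V) :=
  (MonoidHom.toAdditive (quotientConj V q).toMonoidHom).toIntLinearMap

/-- The eigenvalues of an element of `Γ ⧸ V` acting on `V`: the complex eigenvalues of the
induced endomorphism of `ℂ ⊗ V`. -/
def IsQuotientEigenvalue {Γ : Type*} [Group Γ] (V : Subgroup Γ) [V.Normal] [IsMulCommutative V]
    (q : Γ ⧸ V) (z : ℂ) : Prop :=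
  Module.End.HasEigenvalue
    (LinearMap.baseChange ℂ (quotientAction V q) : Module.End ℂ (ℂ ⊗[ℤ] Additive V)) z

/-- The word length of `g` with respect to `S`: the least `n` such that `g` is a product of `n`
elements of `S ∪ S⁻¹`. It is used only when `S` generates, so that such an `n` exists. -/
noncomputable def wordLength {Γ : Type*} [Group Γ] (S : Set Γ) (g : Γ) : ℕ :=
  sInf {n : ℕ | ∃ l : List Γ, l.length = n ∧ (∀ s ∈ l, s ∈ S ∨ s⁻¹ ∈ S) ∧ l.prod = g}

/-- The growth function: the number of elements of word length at most `n`. -/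
noncomputable def growthFunction {Γ : Type*} [Group Γ] (S : Set Γ) (n : ℕ) : ℕ :=
  Set.ncard {g : Γ | wordLength S g ≤ n}

/-- A finitely generated group has polynomial growth if for some degree `d` and every finite
generating set `S`, the growth function is bounded by a constant multiple of `n ^ d`, `n ≥ 1`. -/
def HasPolynomialGrowth (Γ : Type*) [Group Γ] : Prop :=
  Group.FG Γ ∧ ∃ d : ℕ, ∀ S : Set Γ, S.Finite → Subgroup.closure S = ⊤ →
    ∃ C : ℕ, ∀ n : ℕ, 1 ≤ n → growthFunction S n ≤ C * n ^ d

/-! Traces of `Γ` on `ℂ ⊗ V` are integers, and the eigenvalue condition bounds them by the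
dimension, so they take finitely many values. Such a representation is unipotent on a finite-index
subgroup `H` (`exists_finiteIndex_unipotent`): modulo the radical of the trace form, which is a nil
ideal, only finitely many operators occur. As `Γ ⧸ V` is nilpotent, the lower central series of `H`
enters `V` and then descends a finite filtration to the identity (`isNilpotent_of_unipotent`).
Growth follows from virtual nilpotency: in a nilpotent group, collecting the powers of one generator
at a time costs only polynomial length, and a transversal handles finite index. -/

open scoped Pointwise in
/-- A finite subset of a group grows polynomially if the cardinality of its `n`-fold product set
is bounded by a polynomial in `n`. -/
def Finset.GrowsPolynomially {G : Type*} [Group G] [DecidableEq G] (A : Finset G) : Prop :=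
  ∃ C d : ℕ, ∀ n : ℕ, (A ^ n).card ≤ C * (n + 1) ^ d

/-! ### Polynomial growth of virtually nilpotent groups -/

section Growth

open scoped Pointwise commutatorElement

variable {G : Type*} [Group G]

theorem Finset.GrowsPolynomially.mono [DecidableEq G] {A B : Finset G}
    (hB : B.GrowsPolynomially) (h : A ⊆ B) : A.GrowsPolynomially := by
  obtain ⟨C, d, hC⟩ := hB
  exact ⟨C, d, fun n => (Finset.card_le_card (Finset.pow_subset_pow_left h)).trans (hC n)⟩

/-- If `x` is killed by `c` iterations of `⁅s, ·⁆`, then the conjugates of `x` by `s ^ n` have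
polynomially bounded length in the iterated commutators. -/
theorem pow_mul_iterate_commutator_mul_inv_mem_pow [DecidableEq G] {s x : G} {B : Finset G}
    (c : ℕ) (hone : 1 ∈ B) (hB : ∀ j, (fun y => ⁅s, y⁆)^[j] x ∈ B)
    (hc : (fun y => ⁅s, y⁆)^[c] x = 1) (i : ℕ) (hi : i ≤ c) (n : ℕ) :
    s ^ n * (fun y => ⁅s, y⁆)^[c - i] x * (s ^ n)⁻¹ ∈ B ^ ((n + 1) ^ i) := by
  induction i generalizing n with
  | zero => simpa [hc] using hone
  | succ i ih =>
    induction n with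
    | zero => simpa using hB (c - (i + 1))
    | succ n ihn =>
      -- Since `s * y * s⁻¹ = ⁅s, y⁆ * y`, conjugating by one more `s` adds a factor one commutator
      -- deeper, covered by `ih`.
      have h1 := ih (by omega) n
      have hstep : (fun y => ⁅s, y⁆)^[c - i] x = ⁅s, (fun y => ⁅s, y⁆)^[c - (i + 1)] x⁆ := by
        rw [show c - i = (c - (i + 1)) + 1 by omega, Function.iterate_succ_apply']
      have h2 := Finset.mul_mem_mul h1 ihn
      rw [← pow_add] at h2
      have hle : (n + 1) ^ i + (n + 1) ^ (i + 1) ≤ (n + 1 + 1) ^ (i + 1) := by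
        calc (n + 1) ^ i + (n + 1) ^ (i + 1) = (n + 1) ^ i * (n + 1 + 1) := by ring
          _ ≤ (n + 1 + 1) ^ i * (n + 1 + 1) := by gcongr; omega
          _ = _ := by ring
      convert Finset.pow_subset_pow_right hone hle h2 using 1
      rw [hstep, commutatorElement_def]
      group

/-- Collection: push every `s` to the right end. A letter of `X` passed by `s ^ j` becomes its
conjugate by `s ^ j`, with `j ≤ n`. -/
theorem Finset.insert_pow_subset [DecidableEq G] {s : G} {X B : Finset G} {c : ℕ} (hone : 1 ∈ B)
    (hX : ∀ x ∈ X, ∀ n : ℕ, s ^ n * x * (s ^ n)⁻¹ ∈ B ^ ((n + 1) ^ c)) (n : ℕ) :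
    (insert s X) ^ n ⊆ B ^ (n * (n + 1) ^ c) * (Finset.range (n + 1)).image (s ^ ·) := by
  induction n with
  | zero =>
    suffices h : (1 : Finset G) = ∅ ∨ (1 : Finset G) = {1} by simpa using h
    exact Or.inr rfl
  | succ n ih =>
    rw [pow_succ]
    intro g hg
    obtain ⟨g', hg', a, ha, rfl⟩ := Finset.mem_mul.1 hg
    obtain ⟨b, hb, t, ht, rfl⟩ := Finset.mem_mul.1 (ih hg')
    obtain ⟨j, hj, rfl⟩ := Finset.mem_image.1 ht
    have hj' := Finset.mem_range.1 hj
    rcases Finset.mem_insert.1 ha with rfl | ha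
    · refine Finset.mem_mul.2 ⟨b, Finset.pow_subset_pow_right hone ?_ hb, a ^ (j + 1),
        Finset.mem_image.2 ⟨j + 1, Finset.mem_range.2 (by omega), rfl⟩, by simp [pow_succ, mul_assoc]⟩
      gcongr
      all_goals omega
    · have h1 := Finset.mul_mem_mul hb (hX a ha j)
      rw [← pow_add] at h1
      refine Finset.mem_mul.2 ⟨_, Finset.pow_subset_pow_right hone ?_ h1, s ^ j,
        Finset.mem_image.2 ⟨j, Finset.mem_range.2 (by omega), rfl⟩, by simp [mul_assoc]⟩
      calc n * (n + 1) ^ c + (j + 1) ^ c ≤ n * (n + 1 + 1) ^ c + (n + 1 + 1) ^ c := by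
            gcongr
            all_goals omega
        _ = _ := by ring

theorem Finset.GrowsPolynomially.insert_of_conj_mem_pow [DecidableEq G] {s : G} {X B : Finset G} {c : ℕ}
    (hB : B.GrowsPolynomially) (hone : 1 ∈ B)
    (hX : ∀ x ∈ X, ∀ n : ℕ, s ^ n * x * (s ^ n)⁻¹ ∈ B ^ ((n + 1) ^ c)) :
    (insert s X).GrowsPolynomially := by
  obtain ⟨C, d, hC⟩ := hB
  refine ⟨C, (c + 1) * d + 1, fun n => ?_⟩
  calc ((insert s X) ^ n).card
      ≤ (B ^ (n * (n + 1) ^ c)).card * ((Finset.range (n + 1)).image (s ^ ·)).card :=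
        (Finset.card_le_card (Finset.insert_pow_subset hone hX n)).trans Finset.card_mul_le
    _ ≤ (C * (n * (n + 1) ^ c + 1) ^ d) * (n + 1) := by
        gcongr
        · exact hC _
        · exact Finset.card_image_le.trans (by simp)
    _ ≤ (C * (n * (n + 1) ^ c + (n + 1) ^ c) ^ d) * (n + 1) := by
        gcongr
        exact Nat.one_le_pow _ _ (by omega)
    _ = C * (n + 1) ^ ((c + 1) * d + 1) := by rw [pow_succ, pow_mul]; ring

/-- Finite subsets of nilpotent groups grow polynomially. -/
theorem Finset.growsPolynomially_of_isNilpotent [DecidableEq G] (hG : Group.IsNilpotent G)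
    (A : Finset G) : A.GrowsPolynomially := by
  obtain ⟨c, hc⟩ := Subgroup.nilpotent_iff_lowerCentralSeries.1 hG
  set L : ℕ → Subgroup G := (⊤ : Subgroup G).lowerCentralSeries with hL
  have hanti : Antitone L := Subgroup.lowerCentralSeries_antitone _
  have hleft : ∀ i s y, s ∈ L i → ⁅s, y⁆ ∈ L (i + 1) := fun i s y hs =>
    Subgroup.commutator_mem_commutator hs (Subgroup.mem_top y)
  have hright : ∀ i s y, y ∈ L i → ⁅s, y⁆ ∈ L (i + 1) := fun i s y hy => by
    rw [← commutatorElement_inv]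
    exact inv_mem (hleft i y s hy)
  have hiter : ∀ (j : ℕ) (s x : G), (fun y => ⁅s, y⁆)^[j] x ∈ L j := fun j s x => by
    induction j with
    | zero => exact Subgroup.mem_top x
    | succ j ih =>
      rw [Function.iterate_succ_apply']
      exact hright _ _ _ ih
  have hdead : ∀ (j : ℕ) (s x : G), c ≤ j → (fun y => ⁅s, y⁆)^[j] x = 1 := fun j s x hj => by
    have := hanti hj (hiter j s x)
    rwa [hc, Subgroup.mem_bot] at this
  have key : ∀ i w, w + i = c → ∀ A : Finset G, (∀ a ∈ A, a ∈ L w) → A.GrowsPolynomially := by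
    intro i
    induction i with
    | zero =>
      intro w hw A hA
      refine Finset.GrowsPolynomially.mono (B := {1}) ⟨1, 0, fun n => by simp⟩ fun a ha => ?_
      have := hA a ha
      rw [show w = c by omega, hc, Subgroup.mem_bot] at this
      simp [this]
    | succ i ih =>
      intro w hw A hA
      -- Letters of `S₀` are collected one by one. The iterated commutators this creates lie in `L
      -- (w + 1)`, so they enlarge only `S₁`, which is arbitrary in the induction.
      have hstep : ∀ S₀ : Finset G, (∀ a ∈ S₀, a ∈ L w) → ∀ S₁ : Finset G,
          (∀ a ∈ S₁, a ∈ L (w + 1)) → (S₀ ∪ S₁).GrowsPolynomially := by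
        intro S₀
        induction S₀ using Finset.induction_on with
        | empty =>
          intro _ S₁ h₁
          rw [Finset.empty_union]
          exact ih (w + 1) (by omega) S₁ h₁
        | insert s S₀ _ ih₀ =>
          intro h₀ S₁ h₁
          have hs : s ∈ L w := h₀ s (Finset.mem_insert_self _ _)
          set T : Finset G := insert 1 (S₁ ∪ Finset.image₂
            (fun j x => (fun y => ⁅s, y⁆)^[j + 1] x) (Finset.range c) (S₀ ∪ S₁)) with hT
          have hTL : ∀ a ∈ T, a ∈ L (w + 1) := by
            intro a ha
            rcases Finset.mem_insert.1 ha with rfl | ha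
            · exact one_mem _
            rcases Finset.mem_union.1 ha with ha | ha
            · exact h₁ a ha
            obtain ⟨j, -, x, -, rfl⟩ := Finset.mem_image₂.1 ha
            rw [Function.iterate_succ_apply']
            exact hleft _ _ _ hs
          have hone : (1 : G) ∈ S₀ ∪ T := Finset.mem_union_right _ (Finset.mem_insert_self _ _)
          rw [Finset.insert_union]
          refine (ih₀ (fun a ha => h₀ a (Finset.mem_insert_of_mem ha)) T hTL).insert_of_conj_mem_pow (c := c)
            hone fun x hx n => ?_
          have := pow_mul_iterate_commutator_mul_inv_mem_pow (s := s) (x := x) c hone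
            (fun j => ?_) (hdead c s x le_rfl) c le_rfl n
          · simpa using this
          rcases j with _ | j
          · rcases Finset.mem_union.1 hx with hx | hx <;> simp [hT, hx]
          · by_cases hj : j < c
            · exact Finset.mem_union_right _ (Finset.mem_insert_of_mem (Finset.mem_union_right _
                (Finset.mem_image₂.2 ⟨j, Finset.mem_range.2 hj, x, hx, rfl⟩)))
            · rw [hdead _ _ _ (by omega)]
              exact hone
      simpa using hstep A hA ∅ (by simp)
  exact key c 0 (by omega) A fun a _ => Subgroup.mem_top a

theorem Finset.GrowsPolynomially.image {H : Type*} [Group H] [DecidableEq G] [DecidableEq H]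
    {A : Finset G} (hA : A.GrowsPolynomially) (f : G →* H) : (A.image f).GrowsPolynomially := by
  obtain ⟨C, d, hC⟩ := hA
  exact ⟨C, d, fun n => by
    rw [← Finset.image_pow]
    exact Finset.card_image_le.trans (hC n)⟩

theorem Finset.GrowsPolynomially.of_mul_subset_mul [DecidableEq G] {A B T : Finset G}
    (hB : B.GrowsPolynomially) (hT : T.Nonempty) (h : T * A ⊆ B * T) : A.GrowsPolynomially := by
  obtain ⟨C, d, hC⟩ := hB
  refine ⟨C * T.card, d, fun n => ?_⟩
  have hn : T * A ^ n ⊆ B ^ n * T := by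
    induction n with
    | zero => simp
    | succ n ih =>
      calc T * A ^ (n + 1) = T * A ^ n * A := by rw [pow_succ, mul_assoc]
        _ ⊆ B ^ n * T * A := Finset.mul_subset_mul_right ih
        _ = B ^ n * (T * A) := mul_assoc _ _ _
        _ ⊆ B ^ n * (B * T) := Finset.mul_subset_mul_left h
        _ = B ^ (n + 1) * T := by rw [pow_succ, mul_assoc]
  calc (A ^ n).card ≤ (T * A ^ n).card := Finset.card_le_card_mul_left hT
    _ ≤ (B ^ n).card * T.card := (Finset.card_le_card hn).trans Finset.card_mul_le
    _ ≤ C * (n + 1) ^ d * T.card := by gcongr; exact hC n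
    _ = _ := by ring

/-- Finite subsets of virtually nilpotent groups grow polynomially. -/
theorem Finset.growsPolynomially_of_isVirtuallyNilpotent [DecidableEq G]
    (hG : Group.IsVirtuallyNilpotent G) (A : Finset G) : A.GrowsPolynomially := by
  classical
  obtain ⟨H, hH, hfin⟩ := hG
  obtain ⟨T₀, hT₀, -⟩ := H.exists_isComplement_right 1
  let T : Finset G := hT₀.finite_right.toFinset
  -- Schreier-type generators: rewriting `t * a` as `b * t'` gives `T * A ⊆ B * T` with `B` inside
  -- `H`.
  let B : Finset G := (T * A * T⁻¹).filter (· ∈ H)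
  have hB : B.GrowsPolynomially := by
    refine ((Finset.growsPolynomially_of_isNilpotent hH (B.subtype (· ∈ H))).image H.subtype).mono
      fun b hb => ?_
    exact Finset.mem_image.2 ⟨⟨b, (Finset.mem_filter.1 hb).2⟩, Finset.mem_subtype.2 hb, rfl⟩
  have key : ∀ g : G, ∃ t ∈ T, g * t⁻¹ ∈ H := fun g => by
    obtain ⟨t, ht, -⟩ := Subgroup.isComplement_iff_existsUnique_mul_inv_mem.1 hT₀ g
    exact ⟨t, (Set.Finite.mem_toFinset _).2 t.2, ht⟩
  refine hB.of_mul_subset_mul (T := T) ?_ fun g hg => ?_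
  · obtain ⟨t, ht, -⟩ := key 1
    exact ⟨t, ht⟩
  · obtain ⟨t, ht, hgt⟩ := key g
    exact Finset.mem_mul.2 ⟨g * t⁻¹, Finset.mem_filter.2
      ⟨Finset.mul_mem_mul hg (Finset.inv_mem_inv ht), hgt⟩, t, ht, by simp⟩

theorem exists_list_prod_of_closure_eq_top {S : Set G} (hS : Subgroup.closure S = ⊤) (g : G) :
    ∃ l : List G, (∀ s ∈ l, s ∈ S ∨ s⁻¹ ∈ S) ∧ l.prod = g := by
  have hg : g ∈ Subgroup.closure S := hS ▸ Subgroup.mem_top g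
  rw [← Subgroup.mem_toSubmonoid, Subgroup.closure_toSubmonoid] at hg
  obtain ⟨l, hl, h⟩ := Submonoid.exists_list_of_mem_closure hg
  exact ⟨l, hl, h⟩

theorem mem_pow_of_wordLength_le [DecidableEq G] {S : Set G} (hS : Subgroup.closure S = ⊤)
    {A : Finset G} (hone : 1 ∈ A) (hA : ∀ s ∈ S, s ∈ A ∧ s⁻¹ ∈ A) {g : G} {n : ℕ}
    (hg : wordLength S g ≤ n) : g ∈ A ^ n := by
  have hne : {n : ℕ | ∃ l : List G, l.length = n ∧ (∀ s ∈ l, s ∈ S ∨ s⁻¹ ∈ S) ∧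
      l.prod = g}.Nonempty := by
    obtain ⟨l, hl⟩ := exists_list_prod_of_closure_eq_top hS g
    exact ⟨_, l, rfl, hl⟩
  obtain ⟨l, hlen, hl, rfl⟩ := Nat.sInf_mem hne
  refine Finset.pow_subset_pow_right hone (hlen.trans_le hg) ?_
  clear hlen hg hne
  induction l with
  | nil => simp
  | cons a l ih =>
    rw [List.prod_cons, List.length_cons, pow_succ']
    refine Finset.mul_mem_mul ?_ (ih fun s hs => hl s (List.mem_cons_of_mem _ hs))
    rcases hl a List.mem_cons_self with h | h
    · exact (hA a h).1
    · simpa using (hA _ h).2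

theorem Group.IsVirtuallyNilpotent.hasPolynomialGrowth (hG : Group.IsVirtuallyNilpotent G)
    (hfg : Group.FG G) : HasPolynomialGrowth G := by
  classical
  refine ⟨hfg, ?_⟩
  obtain ⟨S₀, hS₀, hfin₀⟩ := Group.fg_iff.1 hfg
  let A : Finset G := insert 1 (hfin₀.toFinset ∪ hfin₀.toFinset⁻¹)
  have hone : 1 ∈ A := Finset.mem_insert_self _ _
  have hA : ∀ s ∈ S₀, s ∈ A ∧ s⁻¹ ∈ A := fun s hs => by simp [A, hs]
  obtain ⟨C, d, hC⟩ := Finset.growsPolynomially_of_isVirtuallyNilpotent hG A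
  refine ⟨d, fun S hfin hS => ?_⟩
  let B : Finset G := insert 1 (hfin.toFinset ∪ hfin.toFinset⁻¹)
  -- Changing generators rescales length by `k`, so only the constant depends on `S`; `d` comes from
  -- `S₀`.
  let k := B.sup (wordLength S₀)
  have hBA : B ⊆ A ^ k := fun b hb =>
    mem_pow_of_wordLength_le hS₀ hone hA (Finset.le_sup (f := wordLength S₀) hb)
  refine ⟨C * (k + 1) ^ d, fun n hn => ?_⟩
  have hsub : {g : G | wordLength S g ≤ n} ⊆ ((A ^ (k * n) : Finset G) : Set G) := fun g hg => by
    have h1 : g ∈ B ^ n := mem_pow_of_wordLength_le hS (Finset.mem_insert_self _ _)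
      (fun s hs => by simp [hs]) hg
    rw [pow_mul]
    exact Finset.pow_subset_pow_left hBA h1
  calc growthFunction S n ≤ (A ^ (k * n)).card := by
        rw [growthFunction, ← Set.ncard_coe_finset]
        exact Set.ncard_le_ncard hsub (Finset.finite_toSet _)
    _ ≤ C * (k * n + 1) ^ d := hC _
    _ ≤ C * (k * n + n) ^ d := by gcongr
    _ = C * (k + 1) ^ d * n ^ d := by rw [mul_assoc, ← mul_pow]; ring

end Growth

/-! ### Unipotence from finitely many character values -/

section Unipotent

variable {K : Type*} [Field K] [CharZero K] {M : Type*} [AddCommGroup M] [Module K M]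
  [FiniteDimensional K M]

open Polynomial in
/-- Over a field of characteristic zero, an endomorphism all of whose positive powers have trace
zero is nilpotent. -/
theorem Module.End.isNilpotent_of_trace_pow_eq_zero (x : Module.End K M)
    (hx : ∀ n, LinearMap.trace K M (x ^ (n + 1)) = 0) : IsNilpotent x := by
  have htr : ∀ p : K[X], LinearMap.trace K M (aeval x (X * p)) = 0 := by
    intro p
    induction p using Polynomial.induction_on' with
    | add p q hp hq => rw [mul_add, map_add, map_add, hp, hq, add_zero]
    | monomial n a =>
      rw [← C_mul_X_pow_eq_monomial, mul_left_comm, ← pow_succ', map_mul, aeval_C, map_pow, aeval_X,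
        ← Algebra.smul_def, map_smul, hx, smul_zero]
  have hne : minpoly K x ≠ 0 := minpoly.ne_zero (Algebra.IsIntegral.isIntegral x)
  obtain ⟨q, hq, hq0⟩ := exists_eq_pow_rootMultiplicity_mul_and_not_dvd (minpoly K x) hne 0
  rw [C_0, sub_zero] at hq hq0
  set a := (minpoly K x).rootMultiplicity 0
  have hcop : IsCoprime (X ^ (a + 1) : K[X]) q :=
    ((prime_X (R := K)).irreducible.coprime_iff_not_dvd.2 hq0).pow_left
  obtain ⟨u, v, huv⟩ := hcop
  have hkill : aeval x (X ^ (a + 1) * q) = 0 := by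
    rw [pow_succ', mul_assoc, ← hq, map_mul, minpoly.aeval, mul_zero]
  -- The Fitting projection onto the part where `x` is invertible. The exponent `a + 1` makes it a
  -- multiple of `X` even when `a = 0`, so its trace vanishes.
  set e := aeval x (u * X ^ (a + 1)) with he
  have hcompl : aeval x (v * q) = 1 - e := by
    rw [eq_sub_iff_add_eq, ← map_add, add_comm, huv, map_one]
  have hidem : IsIdempotentElem e := by
    have : e * (1 - e) = 0 := by
      rw [← hcompl, he, ← map_mul, show u * X ^ (a + 1) * (v * q) = u * v * (X ^ (a + 1) * q) by ring,
        map_mul, hkill, mul_zero]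
    rw [mul_sub, mul_one, sub_eq_zero] at this
    exact this.symm
  have he0 : e = 0 := by
    refine LinearMap.IsIdempotentElem.eq_zero_of_trace_eq_zero hidem ?_
    rw [he, show u * X ^ (a + 1) = X * (u * X ^ a) by ring]
    exact htr _
  refine ⟨a + 1, ?_⟩
  have h1 : aeval x (X ^ (a + 1) * (v * q)) = 0 := by
    rw [mul_left_comm, map_mul, hkill, mul_zero]
  rwa [map_mul, hcompl, he0, sub_zero, mul_one, map_pow, aeval_X] at h1

/-- A nil left ideal is contained in the Jacobson radical. -/
theorem Ideal.le_ringJacobson_of_forall_isNilpotent {R : Type*} [Ring R] {I : Ideal R}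
    (hI : ∀ x ∈ I, IsNilpotent x) : I ≤ Ring.jacobson R := by
  rw [← Ideal.jacobson_bot]
  intro x hx
  rw [Ideal.mem_jacobson_iff]
  intro y
  obtain ⟨z, hz⟩ := (hI _ (I.mul_mem_left y hx)).isUnit_one_add.exists_left_inv
  refine ⟨z, ?_⟩
  rw [Ideal.mem_bot, ← hz]
  noncomm_ring

/-- The filtration of a module by the powers of a nilpotent ideal. -/
theorem Ideal.exists_filtration_of_pow_eq_zero {R M : Type*} [Ring R] [AddCommGroup M]
    [Module R M] {J : Ideal R} {k : ℕ} (hk : J ^ k = 0) :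
    ∃ W : ℕ → Submodule R M, W 0 = ⊤ ∧ W k = ⊥ ∧
      ∀ x ∈ J, ∀ j, ∀ m ∈ W j, x • m ∈ W (j + 1) := by
  have hpow : ∀ (j : ℕ) (N : Submodule R M), (fun N => J • N)^[j] N = J ^ j • N := by
    intro j
    induction j with
    | zero => intro N; rw [Submodule.pow_zero, Ideal.one_eq_top, Submodule.top_smul]; rfl
    | succ j ih => intro N; rw [Function.iterate_succ_apply, ih, Submodule.pow_succ,
        Submodule.mul_smul]
  refine ⟨fun j => (fun N => J • N)^[j] ⊤, rfl, ?_, fun x hx j m hm => ?_⟩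
  · simp only [hpow, hk]
    simp
  · simp only [Function.iterate_succ_apply']
    exact Submodule.smul_mem_smul hx hm

/-- A linear representation over a field of characteristic zero whose character takes only
finitely many values is unipotent on a subgroup of finite index. -/
theorem exists_finiteIndex_unipotent {G : Type*} [Group G] (ρ : G →* Module.End K M)
    (hfin : (Set.range fun g => LinearMap.trace K M (ρ g)).Finite) :
    ∃ H : Subgroup G, H.FiniteIndex ∧ ∃ (W : ℕ → Submodule K M) (k : ℕ), W 0 = ⊤ ∧ W k = ⊥ ∧
      ∀ h ∈ H, ∀ j, ∀ m ∈ W j, ρ h m - m ∈ W (j + 1) := by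
  let A : Subalgebra K (Module.End K M) := Algebra.adjoin K (Set.range ρ)
  have hρA : ∀ g, ρ g ∈ A := fun g => Algebra.subset_adjoin ⟨g, rfl⟩
  have hspan : Subalgebra.toSubmodule A = Submodule.span K (Set.range ρ) := by
    rw [Algebra.adjoin_eq_span, ← MonoidHom.coe_mrange, Submonoid.closure_eq]
  have : IsArtinianRing A := IsArtinianRing.of_finite K A
  -- The radical of the trace form on `A`.
  let I : Ideal A :=
    { carrier := {x | ∀ a : A, LinearMap.trace K M ((x : Module.End K M) * a) = 0}
      add_mem' := fun {x y} hx hy a => by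
        rw [AddMemClass.coe_add, add_mul, map_add, hx, hy, add_zero]
      zero_mem' := fun a => by simp
      smul_mem' := fun b x hx a => by
        rw [smul_eq_mul, MulMemClass.coe_mul, LinearMap.trace_mul_comm, ← mul_assoc,
          LinearMap.trace_mul_comm]
        exact hx (a * b) }
  have hInil : ∀ x ∈ I, IsNilpotent x := by
    intro x hx
    obtain ⟨n, hn⟩ := Module.End.isNilpotent_of_trace_pow_eq_zero (x : Module.End K M) fun n => by
      rw [pow_succ']
      exact hx (x ^ n)
    exact ⟨n, Subtype.ext (by simpa using hn)⟩
  have hIJ : I ≤ Ring.jacobson A := Ideal.le_ringJacobson_of_forall_isNilpotent hInil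
  obtain ⟨k, hk⟩ := IsSemiprimaryRing.isNilpotent (R := A)
  let J : Ideal A := Ring.jacobson A
  let r : G → A := fun g => ⟨ρ g, hρA g⟩
  have hr : ∀ g h, r (g * h) = r g * r h := fun g h => Subtype.ext (map_mul ρ g h)
  have hr1 : r 1 = 1 := Subtype.ext (map_one ρ)
  let H : Subgroup G :=
    { carrier := {g | r g - 1 ∈ J}
      one_mem' := by simp [hr1]
      mul_mem' := fun {g h} hg hh => by
        have : r (g * h) - 1 = r g * (r h - 1) + (r g - 1) := by
          rw [hr, mul_sub, mul_one, sub_add_sub_cancel]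
        rw [Set.mem_ofPred_eq, this]
        exact J.add_mem (J.mul_mem_left _ hh) hg
      inv_mem' := fun {g} hg => by
        have h1 : r g⁻¹ * r g = 1 := by rw [← hr, inv_mul_cancel, hr1]
        have : r g⁻¹ - 1 = -(r g⁻¹ * (r g - 1)) := by
          rw [mul_sub, h1, mul_one, neg_sub]
        rw [Set.mem_ofPred_eq, this]
        exact J.neg_mem (J.mul_mem_left _ hg) }
  obtain ⟨W, hW0, hWk, hW⟩ := Ideal.exists_filtration_of_pow_eq_zero (M := M) hk
  refine ⟨H, ?_, fun j => (W j).restrictScalars K, k, by simp [hW0], by simp [hWk],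
    fun h hh j m hm => hW (r h - 1) hh j m hm⟩
  obtain ⟨s, hs, hspan'⟩ := (Submodule.fg_span_iff_fg_span_finset_subset (Set.range ρ)).1
    (IsNoetherian.noetherian (Submodule.span K (Set.range ρ)))
  -- Because `s` consists of values of `ρ`, these traces are again character values, so `φ` has a
  -- finite target. Since `s` spans, `φ g` determines `r g` modulo `I`.
  let φ : G → s → Set.range fun g => LinearMap.trace K M (ρ g) := fun g t =>
    ⟨LinearMap.trace K M (ρ g * t), by
      obtain ⟨h, hh⟩ := hs t.2
      exact ⟨g * h, by simp only [map_mul, hh]⟩⟩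
  have := hfin.to_subtype
  have hφ : ∀ g h, φ g = φ h → g⁻¹ * h ∈ H := by
    intro g h hgh
    have hI : r h - r g ∈ I := by
      intro a
      obtain ⟨a, haA⟩ := a
      have ha : a ∈ Submodule.span K (s : Set (Module.End K M)) := by
        rw [← hspan', ← hspan]
        exact haA
      change LinearMap.trace K M ((ρ h - ρ g) * a) = 0
      clear haA
      induction ha using Submodule.span_induction with
      | mem x hx =>
        have := congrArg Subtype.val (congrFun hgh ⟨x, hx⟩)
        simp only [φ] at this
        rw [sub_mul, map_sub, this, sub_self]
      | zero => simp
      | add x y _ _ hx hy => rw [mul_add, map_add, hx, hy, add_zero]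
      | smul c x _ hx => rw [mul_smul_comm, map_smul, hx, smul_zero]
    have : r (g⁻¹ * h) - 1 = r g⁻¹ * (r h - r g) := by
      rw [mul_sub, ← hr, ← hr, inv_mul_cancel, hr1]
    change r (g⁻¹ * h) - 1 ∈ J
    rw [this]
    exact J.mul_mem_left _ (hIJ hI)
  have hfq : Finite (G ⧸ H) := by
    refine Finite.of_injective (fun q : G ⧸ H => φ q.out) fun q q' h => ?_
    rw [← q.out_eq', ← q'.out_eq']
    exact QuotientGroup.eq.2 (hφ _ _ h)
  exact Subgroup.finiteIndex_of_finite_quotient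

end Unipotent

/-! ### The conjugation representation on `ℂ ⊗ V` -/

section QuotientRepresentation

open scoped commutatorElement

variable {Γ : Type*} [Group Γ] (V : Subgroup Γ) [V.Normal] [IsMulCommutative V]

/-- The complexified conjugation representation of `Γ` on an abelian normal subgroup. -/
noncomputable def complexQuotientAction : Γ →* Module.End ℂ (ℂ ⊗[ℤ] Additive V) where
  toFun g := (quotientAction V (g : Γ ⧸ V)).baseChange ℂ
  map_one' := by
    have : quotientAction V ((1 : Γ) : Γ ⧸ V) = LinearMap.id := by
      rw [QuotientGroup.mk_one]
      ext x
      simp [quotientAction]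
    rw [this, LinearMap.baseChange_id]
    rfl
  map_mul' g h := by
    have : quotientAction V ((g * h : Γ) : Γ ⧸ V) =
        quotientAction V (g : Γ ⧸ V) ∘ₗ quotientAction V (h : Γ ⧸ V) := by
      rw [QuotientGroup.mk_mul]
      ext x
      simp [quotientAction]
    rw [this, LinearMap.baseChange_comp]
    rfl

theorem complexQuotientAction_one_tmul (g : Γ) (v : V) :
    complexQuotientAction V g (1 ⊗ₜ Additive.ofMul v) =
      1 ⊗ₜ[ℤ] Additive.ofMul (MulAut.conjNormal g v) := rfl

theorem finite_range_trace_complexQuotientAction [Module.Free ℤ (Additive V)]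
    [Module.Finite ℤ (Additive V)]
    (heig : ∀ (q : Γ ⧸ V) (z : ℂ), IsQuotientEigenvalue V q z → ‖z‖ = 1) :
    (Set.range fun g => LinearMap.trace ℂ _ (complexQuotientAction V g)).Finite := by
  set n := Module.finrank ℂ (ℂ ⊗[ℤ] Additive V)
  refine ((Set.finite_Icc (-n : ℤ) n).image (fun t : ℤ => (t : ℂ))).subset ?_
  rintro _ ⟨g, rfl⟩
  set f := complexQuotientAction V g with hf
  have htr : LinearMap.trace ℂ _ f =
      ((LinearMap.trace ℤ _ (quotientAction V (g : Γ ⧸ V)) : ℤ) : ℂ) :=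
    LinearMap.trace_baseChange _ ℂ
  refine ⟨_, ?_, htr.symm⟩
  have hnorm : ‖LinearMap.trace ℂ _ f‖ ≤ n := by
    -- The trace is a sum of at most `n` eigenvalues, each of modulus one.
    rw [Module.End.trace_eq_sum_roots_charpoly_of_splits (IsAlgClosed.splits _)]
    calc ‖f.charpoly.roots.sum‖ ≤ (f.charpoly.roots.map fun z => ‖z‖).sum :=
          norm_multiset_sum_le _
      _ = (f.charpoly.roots.map fun _ => (1 : ℝ)).sum := by
          congr 1
          refine Multiset.map_congr rfl fun z hz => heig (g : Γ ⧸ V) z ?_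
          exact (Module.End.hasEigenvalue_iff_isRoot_charpoly f z).2
            (Polynomial.isRoot_of_mem_roots hz)
      _ = f.charpoly.roots.card := by simp
      _ ≤ n := by
          have := f.charpoly.card_roots'
          rw [LinearMap.charpoly_natDegree] at this
          exact_mod_cast this
  rw [htr, Complex.norm_intCast] at hnorm
  exact Set.mem_Icc.2 (abs_le.1 (by exact_mod_cast hnorm))

/-- A subgroup acting unipotently on a free abelian normal subgroup with nilpotent
quotient is nilpotent. -/
theorem isNilpotent_of_unipotent [Module.Free ℤ (Additive V)]
    (hnil : Group.IsNilpotent (Γ ⧸ V)) {H : Subgroup Γ}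
    {W : ℕ → Submodule ℂ (ℂ ⊗[ℤ] Additive V)} {k : ℕ} (h0 : W 0 = ⊤) (hk : W k = ⊥)
    (hW : ∀ h ∈ H, ∀ j, ∀ m ∈ W j, complexQuotientAction V h m - m ∈ W (j + 1)) :
    Group.IsNilpotent H := by
  obtain ⟨c, hc⟩ := Subgroup.nilpotent_iff_lowerCentralSeries.1 hnil
  let ι : Additive V →ₗ[ℤ] ℂ ⊗[ℤ] Additive V := TensorProduct.mk ℤ ℂ (Additive V) 1
  -- Flatness of `V` ensures that `W k = ⊥` pulls back to the trivial subgroup.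
  have hι : Function.Injective ι := by
    have h := (Module.Flat.rTensor_preserves_injective_linearMap (M := Additive V)
      (Algebra.linearMap ℤ ℂ) (RingHom.injective_int (algebraMap ℤ ℂ))).comp
      (TensorProduct.lid ℤ (Additive V)).symm.injective
    convert h using 1
    ext v
    simp only [Function.comp_apply, TensorProduct.lid_symm_apply, LinearMap.rTensor_tmul,
      Algebra.linearMap_apply, map_one]
    rfl
  let U : ℕ → Subgroup Γ := fun j =>
    (AddSubgroup.toSubgroup' ((W j).toAddSubgroup.comap ι.toAddMonoidHom)).map V.subtype
  have hU : ∀ j (v : V), ι (Additive.ofMul v) ∈ W j → (v : Γ) ∈ U j := fun j v hv =>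
    Subgroup.mem_map.2 ⟨v, hv, rfl⟩
  -- The first `c` steps reach `V`; each later commutator with `h` is `h • v - v` additively, one
  -- step down the filtration.
  have hlcs : ∀ j, H.lowerCentralSeries (c + j) ≤ U j := by
    intro j
    induction j with
    | zero =>
      intro g hg
      have hgV : g ∈ V := by
        have h1 := Subgroup.mem_map_of_mem (QuotientGroup.mk' V) hg
        rw [Subgroup.map_lowerCentralSeries] at h1
        have h2 : QuotientGroup.mk' V g ∈ (⊤ : Subgroup (Γ ⧸ V)).lowerCentralSeries c :=
          Subgroup.lowerCentralSeries_mono c le_top h1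
        rw [hc, Subgroup.mem_bot] at h2
        exact (QuotientGroup.eq_one_iff g).1 h2
      exact hU 0 ⟨g, hgV⟩ (by rw [h0]; trivial)
    | succ j ih =>
      rw [← add_assoc, Subgroup.lowerCentralSeries_succ, Subgroup.commutator_le]
      intro g hg h hh
      obtain ⟨v, hv, rfl⟩ := Subgroup.mem_map.1 (ih hg)
      rw [← commutatorElement_inv]
      refine inv_mem ?_
      have : ⁅h, V.subtype v⁆ = ((MulAut.conjNormal h v * v⁻¹ : V) : Γ) := by
        simp [commutatorElement_def, MulAut.conjNormal_apply]
      rw [this]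
      refine hU _ _ ?_
      have h1 := hW h hh j _ hv
      have h2 : ι (Additive.ofMul (MulAut.conjNormal h v * v⁻¹)) =
          ι (Additive.ofMul (MulAut.conjNormal h v)) - ι (Additive.ofMul v) := by
        rw [ofMul_mul, ofMul_inv, map_add, map_neg, sub_eq_add_neg]
      rw [h2]
      exact h1
  refine Subgroup.nilpotent_iff_lowerCentralSeries.2 ⟨c + k, ?_⟩
  rw [← Subgroup.map_eq_bot_iff_of_injective _ H.subtype_injective,
    Subgroup.top_subtype_lowerCentralSeries, eq_bot_iff]
  intro g hg
  obtain ⟨v, hv, rfl⟩ := Subgroup.mem_map.1 (hlcs k hg)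
  have h1 : ι (Additive.ofMul v) ∈ W k := hv
  rw [hk, Submodule.mem_bot] at h1
  have h2 : Additive.ofMul v = 0 := hι (by rw [h1, map_zero])
  have h3 : v = 1 := h2
  simp [h3]

end QuotientRepresentation

theorem proposition3p3 {Γ : Type*} [Group Γ] (hΓ : Group.FG Γ)
    (V : Subgroup Γ) [V.Normal] [IsMulCommutative V]
    (hfree : Module.Free ℤ (Additive V)) (r : ℕ) (hrank : Module.rank ℤ (Additive V) = r)
    (hnil : Group.IsNilpotent (Γ ⧸ V))
    (heig : ∀ (q : Γ ⧸ V) (z : ℂ), IsQuotientEigenvalue V q z → ‖z‖ = 1) :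
    Group.IsVirtuallyNilpotent Γ ∧ HasPolynomialGrowth Γ := by
  have hfinite : Module.Finite ℤ (Additive V) :=
    Module.rank_lt_aleph0_iff.1 (hrank ▸ Cardinal.natCast_lt_aleph0)
  obtain ⟨H, hH, W, k, h0, hk, hW⟩ := exists_finiteIndex_unipotent (complexQuotientAction V)
    (finite_range_trace_complexQuotientAction V heig)
  have hvirt : Group.IsVirtuallyNilpotent Γ := ⟨H, isNilpotent_of_unipotent V hnil h0 hk hW, hH⟩
  exact ⟨hvirt, hvirt.hasPolynomialGrowth hΓ⟩
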